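/- Let $G=(V,E)$ be a finite simple undirected graph that contains a cycle, let $m\ge 2$ be an integer, and suppose that the girth of $G$ (the length of its shortest cycle) is at least $2m+1$. Let $B$ be the non-backtracking matrix of $G$, indexed by the directed edges of $G$, with $B_{i\to j,\,k\to\ell}=1$ if $j=k$ and $i\ne\ell$, and $B_{i\to j,\,k\to\ell}=0$ otherwise, and let $\rho$ be its spectral radius (the largest modulus of a complex eigenvalue of $B$). For a real number $k>1$, a $k$-vector colouring of $G$ assigns to every vertex $i$ a unit vector $v_i$ in some $\mathbb{R}^d$ such that $\langle v_i,v_j\rangle\le -(k-1)^{-1}$ for every edge $\{i,j\}\in E$. Let $\chi_v(G)$ be the infimum of the $k$ for which $G$ has a $k$-vector colouring. Then $$\chi_v(G)\le \frac{\rho+1}{2(1-1/m)\sqrt{\rho}}+1 .$$ In particular, this holds for every nonempty finite connected graph of minimum degree at least $2$ and girth at least $2m+1$ that is neither bipartite nor a subdivision. -/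

import Mathlib

namespace SimpleGraph

/-- A `k`-vector colouring of `G` in `ℝ^d`, for a real number `k > 1`: a unit vector for every
vertex, such that the vectors at the two ends of any edge have inner product at most
`-(k - 1)⁻¹`. -/
def IsVectorColoring {V : Type*} (G : SimpleGraph V) (k : ℝ) {d : ℕ}
    (v : V → EuclideanSpace ℝ (Fin d)) : Prop :=
  1 < k ∧ (∀ i, ‖v i‖ = 1) ∧ ∀ i j, G.Adj i j → inner ℝ (v i) (v j) ≤ -(k - 1)⁻¹

/-- `G` has a `k`-vector colouring, in some Euclidean space of finite dimension. -/
def VectorColorable {V : Type*} (G : SimpleGraph V) (k : ℝ) : Prop :=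
  ∃ (d : ℕ) (v : V → EuclideanSpace ℝ (Fin d)), G.IsVectorColoring k v

/-- The vector chromatic number `χ_v(G)`: the least real `k` for which `G` has a `k`-vector
colouring. -/
noncomputable def vectorChromaticNumber {V : Type*} (G : SimpleGraph V) : ℝ :=
  sInf {k : ℝ | G.VectorColorable k}

/-- The infimum defining `χ_v(G)` is over a set that is bounded below. -/
theorem bddBelow_vectorColorable {V : Type*} (G : SimpleGraph V) :
    BddBelow {k : ℝ | G.VectorColorable k} :=
  ⟨1, fun _ ⟨_, _, h⟩ => h.1.le⟩

/-- For a finite graph, the infimum defining `χ_v(G)` is over a nonempty set. -/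
theorem nonempty_vectorColorable {V : Type*} [Finite V] (G : SimpleGraph V) :
    {k : ℝ | G.VectorColorable k}.Nonempty := by
  obtain ⟨n, ⟨e⟩⟩ := Finite.exists_equiv_fin V
  have hN : (0 : ℝ) < (n : ℝ) + 1 := by positivity
  set s : EuclideanSpace ℝ (Fin (n + 2)) :=
    ∑ l, EuclideanSpace.single l (1 : ℝ) with hs
  set w : Fin (n + 2) → EuclideanSpace ℝ (Fin (n + 2)) :=
    fun l => EuclideanSpace.single l (1 : ℝ) - ((n : ℝ) + 2)⁻¹ • s with hw
  have key : ∀ a b, inner ℝ (w a) (w b) = (if a = b then (1 : ℝ) else 0) - ((n : ℝ) + 2)⁻¹ := by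
    intro a b
    have h1 : ∀ c, s c = 1 := by
      intro c
      simp [hs, Pi.single_apply]
    have h2 : inner ℝ s s = (n : ℝ) + 2 := by
      rw [PiLp.inner_apply]
      simp [h1]
    have h3 : inner ℝ (EuclideanSpace.single a (1 : ℝ)) s = 1 := by
      simp [EuclideanSpace.inner_single_left, h1]
    have h4 : inner ℝ s (EuclideanSpace.single b (1 : ℝ)) = 1 := by
      simp [EuclideanSpace.inner_single_right, h1]
    have h5 : inner ℝ (EuclideanSpace.single a (1 : ℝ) : EuclideanSpace ℝ (Fin (n + 2)))
        (EuclideanSpace.single b (1 : ℝ)) = if a = b then (1 : ℝ) else 0 := by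
      simp [EuclideanSpace.inner_single_left]
    simp only [hw, inner_sub_left, inner_sub_right, inner_smul_left, inner_smul_right, h2, h3, h4,
      h5, RCLike.conj_to_real]
    field_simp
    ring
  have hnorm : ∀ a, ‖w a‖ ^ 2 = 1 - ((n : ℝ) + 2)⁻¹ := by
    intro a
    rw [← real_inner_self_eq_norm_sq, key]
    simp
  have hc : (0 : ℝ) < 1 - ((n : ℝ) + 2)⁻¹ := by
    rw [sub_pos]
    exact inv_lt_one_of_one_lt₀ (by linarith)
  have hpos : ∀ a, 0 < ‖w a‖ := by
    intro a
    rcases (norm_nonneg (w a)).lt_or_eq with h | h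
    · exact h
    · have := hnorm a
      rw [← h] at this
      simp at this
      simp at hc
      linarith
  refine ⟨(n : ℝ) + 2, n + 2, fun x => ‖w (Fin.castAdd 2 (e x))‖⁻¹ • w (Fin.castAdd 2 (e x)),
    by linarith, ?_, ?_⟩
  · intro i
    rw [norm_smul, norm_inv, norm_norm]
    exact inv_mul_cancel₀ (hpos _).ne'
  · intro i j hij
    have hne : Fin.castAdd 2 (e i) ≠ Fin.castAdd 2 (e j) := by
      intro h
      exact hij.ne (e.injective (Fin.castAdd_injective n 2 h))
    have heq : ‖w (Fin.castAdd 2 (e j))‖ = ‖w (Fin.castAdd 2 (e i))‖ := by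
      rw [← sq_eq_sq₀ (norm_nonneg _) (norm_nonneg _), hnorm, hnorm]
    rw [inner_smul_left, inner_smul_right, key, if_neg hne, heq, RCLike.conj_to_real, ← mul_assoc,
      ← mul_inv, ← sq, hnorm]
    apply le_of_eq
    have : (n : ℝ) + 2 - 1 ≠ 0 := by linarith
    field_simp
    ring

/-- The non-backtracking matrix `B` of `G`, indexed by the directed edges of `G`: the entry at
`(i → j, k → l)` is `1` if `j = k` and `i ≠ l`, and `0` otherwise. -/
def nonBacktrackingMatrix {V : Type*} [DecidableEq V] (G : SimpleGraph V) :
    Matrix G.Dart G.Dart ℂ :=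
  Matrix.of fun e f => if e.snd = f.fst ∧ e.fst ≠ f.snd then 1 else 0

/-- The spectral radius `ρ` of the non-backtracking matrix: the largest modulus of its complex
eigenvalues. -/
noncomputable def nonBacktrackingRadius {V : Type*} [Fintype V] [DecidableEq V]
    (G : SimpleGraph V) [DecidableRel G.Adj] : ℝ :=
  (spectralRadius ℂ G.nonBacktrackingMatrix).toReal

end SimpleGraph

/-! Fix σ > ρ. The Neumann series solves Bφ + σ = σφ with φ ≥ 1. Attaching a ray to every vertex,
with weights σ, σ², ... along it, absorbs the inhomogeneous term: in the enlarged graph the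
successors of each element have total weight σ times its own. The rays also remove any need for
minimum degree or connectedness. Only the first m elements of each ray matter.

Below half the girth G looks like a tree from each vertex i, so each element at depth r + 1 ≥ 2 has
exactly one predecessor at depth r. Hence the mass at depth r is σ^(r-1) S_i. Let v_i have the entry
(-1)^r √(w/(m σ^(r-1) S_i)) at an element of weight w and depth r, for 1 ≤ r ≤ m. This is a unit
vector.

For an edge ij, depths in the common support differ by exactly one, so every product of entries is
nonpositive. The descendants of i → j and of j → i contribute at most -√σ (φ_ij + φ_ji)/(m √(S_i
S_j)) on each of m - 1 levels. Since S_i = φ_ij + σ φ_ji, AM-GM gives 2√(S_i S_j) ≤ (σ + 1)(φ_ij +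
φ_ji), so the inner product is at most -2(1 - 1/m)√σ/(σ + 1). Finally let σ decrease to ρ; a cycle
forces ρ ≥ 1, so the bound is continuous there. -/

/-! ### Neumann series of a nonnegative matrix. -/

section SpectralRadius

open scoped Matrix

attribute [local instance] Matrix.linftyOpNormedRing Matrix.linftyOpNormedAlgebra

/-- Beyond the spectral radius of a nonnegative matrix `M`, the Neumann series applied to the
constant vector `1` converges to a solution `φ ≥ 1` of `M φ + σ = σ φ`. -/
theorem Matrix.exists_one_le_mulVec_add_eq_smul {n : Type*} [Fintype n] [DecidableEq n]
    (M : Matrix n n ℝ) (hM : ∀ i j, 0 ≤ M i j) {σ : ℝ}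
    (hσ : (spectralRadius ℂ (M.map ((↑) : ℝ → ℂ))).toReal < σ) :
    ∃ φ : n → ℝ, (∀ i, 1 ≤ φ i) ∧ ∀ i, ∑ j, M i j * φ j + σ = σ * φ i := by
  cases isEmpty_or_nonempty n
  · exact ⟨fun _ => 1, fun i => isEmptyElim i, fun i => isEmptyElim i⟩
  set a : Matrix n n ℂ := M.map ((↑) : ℝ → ℂ) with ha
  obtain ⟨τ, hτ, hτσ⟩ := exists_between hσ
  have hτ0 : 0 ≤ τ := ENNReal.toReal_nonneg.trans hτ.le
  have hσ0 : 0 < σ := hτ0.trans_lt hτσ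
  set c : ℕ → n → ℝ := fun t => (M ^ t) *ᵥ (fun _ => 1) with hc
  have hc0 : ∀ i, c 0 i = 1 := fun i => by simp [hc]
  have hcs : ∀ t i, c (t + 1) i = ∑ j, M i j * c t j := fun t i => by
    simp only [hc, pow_succ', ← Matrix.mulVec_mulVec]
    rfl
  have hcnn : ∀ t i, 0 ≤ c t i := by
    intro t
    induction t with
    | zero => intro i; simp [hc0]
    | succ t ih =>
      intro i
      rw [hcs]
      exact Finset.sum_nonneg fun j _ => mul_nonneg (hM i j) (ih j)
  have hca : ∀ t i, ((a ^ t) *ᵥ (fun _ => 1)) i = (c t i : ℂ) := by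
    intro t
    induction t with
    | zero => intro i; simp [hc0]
    | succ t ih =>
      intro i
      rw [hcs, pow_succ', ← Matrix.mulVec_mulVec]
      simp [Matrix.mulVec, dotProduct, ha] at ih ⊢
      simp [ih]
  have hbound : ∀ t i, c t i ≤ ‖a ^ t‖ := by
    intro t i
    have h1 := Matrix.linfty_opNorm_mulVec (a ^ t) (fun _ => (1 : ℂ))
    have h2 := norm_le_pi_norm ((a ^ t) *ᵥ (fun _ => (1 : ℂ))) i
    rw [hca, Complex.norm_real, Real.norm_of_nonneg (hcnn t i)] at h2
    have h3 : ‖(fun _ => 1 : n → ℂ)‖ = 1 := by simp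
    rw [h3, mul_one] at h1
    exact h2.trans h1
  have hfin : spectralRadius ℂ a ≠ ⊤ := by
    obtain ⟨z, -, hz⟩ := spectrum.exists_nnnorm_eq_spectralRadius a
    rw [← hz]
    exact ENNReal.coe_ne_top
  -- Gelfand's formula, with τ strictly between the spectral radius and σ so that the series is
  -- dominated by a geometric one of ratio τ/σ < 1.
  have hgelfand : ∀ᶠ t : ℕ in Filter.atTop, ‖a ^ t‖ ≤ τ ^ t := by
    have h1 := (ENNReal.tendsto_toReal hfin).comp
      (spectrum.pow_nnnorm_pow_one_div_tendsto_nhds_spectralRadius a)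
    filter_upwards [h1.eventually_lt_const hτ, Filter.eventually_ge_atTop 1] with t ht ht1
    have ht' : ‖a ^ t‖ ^ ((t : ℝ)⁻¹) < τ := by
      simpa [← ENNReal.toReal_rpow] using ht
    calc ‖a ^ t‖ = (‖a ^ t‖ ^ ((t : ℝ)⁻¹)) ^ t :=
          (Real.rpow_inv_natCast_pow (norm_nonneg _) (by omega)).symm
      _ ≤ τ ^ t := by gcongr
  have hsum : ∀ i, Summable fun t => (σ⁻¹) ^ t * c t i := by
    intro i
    refine Summable.of_norm_bounded_eventually_nat (g := fun t => (σ⁻¹ * τ) ^ t) ?_ ?_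
    · refine summable_geometric_of_lt_one (by positivity) ?_
      rw [inv_mul_lt_one₀ hσ0]
      exact hτσ
    · filter_upwards [hgelfand] with t ht
      rw [Real.norm_of_nonneg (mul_nonneg (by positivity) (hcnn t i)), mul_pow]
      gcongr
      exact (hbound t i).trans ht
  have hstep : ∀ i, ∑' t, (σ⁻¹) ^ t * c t i
      = 1 + σ⁻¹ * ∑ j, M i j * ∑' t, (σ⁻¹) ^ t * c t j := by
    intro i
    rw [(hsum i).tsum_eq_zero_add]
    simp only [pow_zero, hc0, one_mul, ← tsum_mul_left]
    rw [← Summable.tsum_finsetSum fun j _ => (hsum j).mul_left _, ← tsum_mul_left]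
    congr 2
    funext t
    rw [hcs, pow_succ', Finset.mul_sum, Finset.mul_sum]
    exact Finset.sum_congr rfl fun j _ => by ring
  refine ⟨fun i => ∑' t, (σ⁻¹) ^ t * c t i, fun i => ?_, fun i => ?_⟩
  · dsimp only
    rw [hstep]
    have : 0 ≤ σ⁻¹ * ∑ j, M i j * ∑' t, (σ⁻¹) ^ t * c t j :=
      mul_nonneg (by positivity) <| Finset.sum_nonneg fun j _ => mul_nonneg (hM i j) <|
        tsum_nonneg fun t => mul_nonneg (by positivity) (hcnn t j)
    linarith
  · dsimp only
    rw [hstep i]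
    field_simp
    ring

end SpectralRadius

/-! ### Geodesics below half the girth. -/

namespace SimpleGraph

variable {V : Type*} {G : SimpleGraph V}

/-- Two different paths with common ends contain a cycle, so their total length is at least the
girth. -/
theorem Walk.IsPath.eq_of_length_add_lt_egirth {u v : V} {p q : G.Walk u v} (hp : p.IsPath)
    (hq : q.IsPath) (h : ((p.length + q.length : ℕ) : ℕ∞) < G.egirth) : p = q := by
  set H := fromEdgeSet {e | e ∈ p.edges ∨ e ∈ q.edges} with hH
  have hedge : ∀ e, e ∈ H.edgeSet → e ∈ p.edges ++ q.edges := fun e he => by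
    rw [hH, edgeSet_fromEdgeSet] at he
    simpa using he.1
  have hle : H ≤ G := fun x y hxy => by
    have := hedge s(x, y) hxy
    rw [List.mem_append] at this
    exact this.elim (fun h => p.edges_subset_edgeSet h) (fun h => q.edges_subset_edgeSet h)
  -- A cycle in the union of the two paths has at most as many edges as both together, fewer than
  -- the girth. So the union is a forest, where paths are unique.
  have hac : H.IsAcyclic := fun x c hc => by
    have h1 : c.length ≤ p.length + q.length := by
      have : c.edges ⊆ p.edges ++ q.edges := fun e he => hedge e (c.edges_subset_edgeSet he)
      simpa using (hc.edges_nodup.subperm this).length_le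
    have h2 := egirth_le_length (hc.mapLe hle)
    rw [Walk.length_map] at h2
    exact absurd (h2.trans (by exact_mod_cast h1)) h.not_ge
  have hpH : ∀ e ∈ p.edges, e ∈ H.edgeSet := fun e he => by
    rw [hH, edgeSet_fromEdgeSet]
    exact ⟨Or.inl he, G.not_isDiag_of_mem_edgeSet (p.edges_subset_edgeSet he)⟩
  have hqH : ∀ e ∈ q.edges, e ∈ H.edgeSet := fun e he => by
    rw [hH, edgeSet_fromEdgeSet]
    exact ⟨Or.inr he, G.not_isDiag_of_mem_edgeSet (q.edges_subset_edgeSet he)⟩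
  have := (hac.subsingleton_path u v).elim ⟨_, hp.transfer hpH⟩ ⟨_, hq.transfer hqH⟩
  have h3 := congrArg (fun r => (Walk.mapLe hle r.1).support) this
  apply Walk.ext_support
  simpa using h3

/-- Below half the girth, a vertex has only one neighbour closer to a given vertex. -/
theorem eq_of_adj_of_dist_add_one {i a a' b : V} {m : ℕ}
    (hg : ((2 * m + 1 : ℕ) : ℕ∞) ≤ G.egirth) (ha : G.Adj a b) (ha' : G.Adj a' b)
    (hr : G.Reachable i b) (hd : G.dist i b = G.dist i a + 1) (hd' : G.dist i b = G.dist i a' + 1)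
    (hm : G.dist i b ≤ m) : a = a' := by
  obtain ⟨p, hp⟩ := (hr.trans ha.symm.reachable).exists_walk_length_eq_dist
  obtain ⟨q, hq⟩ := (hr.trans ha'.symm.reachable).exists_walk_length_eq_dist
  have h1 : (p.concat ha).IsPath := Walk.isPath_of_length_eq_dist _ (by simp [hp, hd])
  have h2 : (q.concat ha').IsPath := Walk.isPath_of_length_eq_dist _ (by simp [hq, hd'])
  have h3 := h1.eq_of_length_add_lt_egirth h2 <| lt_of_lt_of_le (by
    simp only [Walk.length_concat]
    exact_mod_cast (by omega)) hg
  simpa using congrArg Walk.penultimate h3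

/-- Adjacent vertices at the same distance from a vertex are at least half the girth away. -/
theorem le_dist_of_adj_of_dist_eq {i b c : V} {m : ℕ}
    (hg : ((2 * m + 1 : ℕ) : ℕ∞) ≤ G.egirth) (hbc : G.Adj b c) (hr : G.Reachable i b)
    (hd : G.dist i b = G.dist i c) : m ≤ G.dist i b := by
  by_contra! hlt
  obtain ⟨p, hpp, hp⟩ := hr.exists_path_of_dist
  obtain ⟨q, hqp, hq⟩ := (hr.trans hbc.reachable).exists_path_of_dist
  -- So the geodesic to c extends by the edge cb to a path one longer than the geodesic to b;
  -- together they have length 2 · dist + 1 < 2m + 1.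
  have hb : b ∉ q.support := fun hb => by
    classical
    have h1 := dist_le (q.takeUntil b hb)
    have h2 := congrArg Walk.length (q.take_spec hb)
    rw [Walk.length_append] at h2
    have h3 : (q.dropUntil b hb).length = 0 := by omega
    exact hbc.ne (Walk.eq_of_length_eq_zero h3)
  have h3 := hpp.eq_of_length_add_lt_egirth (hqp.concat hb hbc.symm) <| lt_of_lt_of_le (by
    simp only [Walk.length_concat]
    exact_mod_cast (by omega)) hg
  have := congrArg Walk.length h3
  simp at this
  omega

end SimpleGraph

/-! ### Vector colourings from weighted depth levels. -/

namespace SimpleGraph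

open Finset

variable {V : Type*} {G : SimpleGraph V}

/-- A `k`-vector colouring may take its vectors in `ℝ^ι` for any finite index type `ι`. -/
theorem vectorColorable_of_euclideanSpace {ι : Type*} [Fintype ι] {k : ℝ} (hk : 1 < k)
    (v : V → EuclideanSpace ℝ ι) (hv : ∀ i, ‖v i‖ = 1)
    (hadj : ∀ i j, G.Adj i j → inner ℝ (v i) (v j) ≤ -(k - 1)⁻¹) : G.VectorColorable k := by
  let L := LinearIsometryEquiv.piLpCongrLeft 2 ℝ ℝ (Fintype.equivFin ι)
  refine ⟨Fintype.card ι, fun i => L (v i), hk, fun i => ?_, fun i j hij => ?_⟩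
  · rw [L.norm_map, hv]
  · rw [L.inner_map_map]
    exact hadj i j hij

/-- A vector colouring from weights on depth levels. Every vertex `i` assigns to each element of
`ι` a depth; the mass at depth `r` grows geometrically with ratio `σ`, the depths seen from two
adjacent vertices differ by exactly one, and the mass that is one level deeper from `i` than from
`j` grows geometrically too. The alternating square roots of the normalised weights, truncated at
depth `m`, form a vector colouring. -/
theorem vectorColorable_of_depth {ι : Type*} [Fintype ι] {m : ℕ} (hm : 2 ≤ m) {σ : ℝ}
    (hσ : 0 < σ) (w : ι → ℝ) (hw : ∀ x, 0 ≤ w x) (depth : V → ι → ℕ) (S : V → ℝ)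
    (hS : ∀ i, 0 < S i)
    (hmass : ∀ i r, 1 ≤ r → r ≤ m → ∑ x with depth i x = r, w x = σ ^ (r - 1) * S i)
    (hdepth : ∀ i j, G.Adj i j → ∀ x, 1 ≤ depth i x → depth i x ≤ m → 1 ≤ depth j x →
      depth j x ≤ m → depth i x = depth j x + 1 ∨ depth j x = depth i x + 1)
    (φ : V → V → ℝ) (hφ : ∀ i j, G.Adj i j → 0 ≤ φ i j)
    (hSφ : ∀ i j, G.Adj i j → S i = φ i j + σ * φ j i)
    (hadj : ∀ i j, G.Adj i j → ∀ r, 1 ≤ r → r < m →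
      σ ^ r * φ i j ≤ ∑ x with depth i x = r + 1 ∧ depth j x = r, w x) :
    G.VectorColorable ((σ + 1) / (2 * (1 - 1 / (m : ℝ)) * √σ) + 1) := by
  have hm0 : (0 : ℝ) < m := by positivity
  have hm1 : (0 : ℝ) < 1 - 1 / (m : ℝ) := by
    rw [sub_pos, div_lt_one hm0]
    exact_mod_cast (by omega : 1 < m)
  have hsq : 0 < √σ := Real.sqrt_pos.2 hσ
  -- Each of the m levels receives squared norm 1/m, and the signs make products across consecutive
  -- levels nonpositive. Depth 0 means "not seen from i" and is left out.
  set v : V → EuclideanSpace ℝ ι := fun i => WithLp.toLp 2 fun x =>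
    if depth i x ∈ Icc 1 m then (-1) ^ depth i x * √(w x / (m * (σ ^ (depth i x - 1) * S i)))
    else 0 with hv
  have hvx : ∀ i x, v i x = if depth i x ∈ Icc 1 m then
    (-1) ^ depth i x * √(w x / (m * (σ ^ (depth i x - 1) * S i))) else 0 := fun i x => rfl
  refine vectorColorable_of_euclideanSpace (by
    have : 0 < (σ + 1) / (2 * (1 - 1 / (m : ℝ)) * √σ) := by positivity
    linarith) v (fun i => ?_) (fun i j hij => ?_)
  · have hSi := hS i
    have hterm : ∀ r ∈ Icc 1 m, ∑ x with depth i x = r, v i x ^ 2 = 1 / m := by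
      intro r hr
      have h1 : ∀ x ∈ univ.filter (fun x => depth i x = r),
          v i x ^ 2 = w x / (m * (σ ^ (r - 1) * S i)) := by
        intro x hx
        rw [mem_filter] at hx
        have := hw x
        rw [hvx, hx.2, if_pos hr, mul_pow, Real.sq_sqrt (by positivity), ← pow_mul, mul_comm r,
          pow_mul]
        simp
      rw [sum_congr rfl h1, ← sum_div, hmass i r (mem_Icc.1 hr).1 (mem_Icc.1 hr).2]
      field_simp
    have hnorm : ‖v i‖ ^ 2 = 1 := by
      rw [EuclideanSpace.norm_sq_eq]
      simp only [Real.norm_eq_abs, sq_abs]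
      rw [← sum_filter_add_sum_filter_not univ (fun x => depth i x ∈ Icc 1 m)
        (fun x => v i x ^ 2), ← sum_fiberwise_of_maps_to (s := univ.filter _)
        (t := Icc 1 m) (g := depth i) (fun x hx => (mem_filter.1 hx).2)]
      rw [sum_eq_zero (s := univ.filter fun x => ¬ depth i x ∈ Icc 1 m) fun x hx => by
        rw [hvx, if_neg (mem_filter.1 hx).2]; simp]
      rw [add_zero, sum_congr rfl fun r hr => ?_, sum_congr rfl hterm]
      · simp
        field_simp
      · rw [filter_filter]
        congr 1
        ext x
        simp only [mem_filter, mem_univ, true_and]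
        exact ⟨fun h => h.2, fun h => ⟨h ▸ hr, h⟩⟩
    nlinarith [norm_nonneg (v i)]
  · have hSi := hS i
    have hSj := hS j
    have hi := hφ i j hij
    have hj := hφ j i hij.symm
    set C : ℝ := √(S i) * √(S j) with hC
    have hC0 : 0 < C := mul_pos (Real.sqrt_pos.2 hSi) (Real.sqrt_pos.2 hSj)
    have hCsq : C ^ 2 = S i * S j := by
      rw [hC, mul_pow, Real.sq_sqrt hSi.le, Real.sq_sqrt hSj.le]
    -- AM-GM, as the right side is S i + S j.
    have hCle : 2 * C ≤ (σ + 1) * (φ i j + φ j i) := by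
      refine le_of_sq_le_sq ?_ (by positivity)
      have h1 := hSφ i j hij
      have h2 := hSφ j i hij.symm
      rw [mul_pow, hCsq]
      nlinarith [sq_nonneg (S i - S j)]
    have hpair : ∀ a b x, 0 < S a → 0 < S b → ∀ r, 1 ≤ r → r < m → depth a x = r + 1 →
        depth b x = r → v a x * v b x = -(w x / (m * (σ ^ (r - 1) * √σ * (√(S a) * √(S b))))) := by
      intro a b x ha hb r hr hrm hax hbx
      have hwx := hw x
      rw [hvx, hvx, hax, hbx, if_pos (by simp; omega), if_pos (by simp; omega)]
      have hneg : (-1 : ℝ) ^ (r + 1) * (-1) ^ r = -1 := by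
        rw [pow_succ, mul_assoc, mul_comm (-1 : ℝ), ← mul_assoc, ← pow_add, ← two_mul, pow_mul]
        simp
      have hroot : √(w x / (m * (σ ^ (r + 1 - 1) * S a))) * √(w x / (m * (σ ^ (r - 1) * S b)))
          = w x / (m * (σ ^ (r - 1) * √σ * (√(S a) * √(S b)))) := by
        rw [← Real.sqrt_mul (by positivity), Real.sqrt_eq_iff_eq_sq (by positivity)
          (by positivity)]
        obtain ⟨s, rfl⟩ : ∃ s, r = s + 1 := ⟨r - 1, by omega⟩
        simp only [add_tsub_cancel_right, div_pow, mul_pow, Real.sq_sqrt hσ.le,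
          Real.sq_sqrt ha.le, Real.sq_sqrt hb.le]
        field_simp
        ring
      calc _ = ((-1 : ℝ) ^ (r + 1) * (-1) ^ r) * (√(w x / (m * (σ ^ (r + 1 - 1) * S a))) *
            √(w x / (m * (σ ^ (r - 1) * S b)))) := by ring
        _ = _ := by rw [hneg, hroot]; ring
    have hpt : ∀ x, v i x * v j x = -∑ r ∈ Ico 1 m,
        ((if depth i x = r + 1 ∧ depth j x = r then w x else 0) +
          (if depth j x = r + 1 ∧ depth i x = r then w x else 0)) /
            (m * (σ ^ (r - 1) * √σ * C)) := by
      intro x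
      by_cases hx : depth i x ∈ Icc 1 m ∧ depth j x ∈ Icc 1 m
      · obtain ⟨⟨hi1, him⟩, hj1, hjm⟩ := hx.imp mem_Icc.1 mem_Icc.1
        rcases hdepth i j hij x hi1 him hj1 hjm with h | h
        · rw [sum_eq_single (depth j x), hpair i j x hSi hSj _ hj1 (by omega) h rfl, if_pos ⟨h, rfl⟩,
            if_neg (by omega), add_zero]
          · intro r _ hr
            rw [if_neg (by omega), if_neg (by omega), add_zero, zero_div]
          · intro hr
            exact absurd (mem_Ico.2 ⟨hj1, by omega⟩) hr
        · rw [sum_eq_single (depth i x), mul_comm (v i x), hpair j i x hSj hSi _ hi1 (by omega) h rfl,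
            if_neg (by omega), if_pos ⟨h, rfl⟩, zero_add, mul_comm (√(S j))]
          · intro r _ hr
            rw [if_neg (by omega), if_neg (by omega), add_zero, zero_div]
          · intro hr
            exact absurd (mem_Ico.2 ⟨hi1, by omega⟩) hr
      · have h0 : v i x * v j x = 0 := by
          rw [hvx, hvx]
          by_cases h : depth i x ∈ Icc 1 m
          · rw [if_neg fun h' => hx ⟨h, h'⟩, mul_zero]
          · rw [if_neg h, zero_mul]
        rw [h0, sum_eq_zero, neg_zero]
        intro r hr
        rw [mem_Ico] at hr
        simp only [mem_Icc] at hx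
        rw [if_neg (by omega), if_neg (by omega), add_zero, zero_div]
    have hinner : inner ℝ (v i) (v j) = ∑ x, v i x * v j x := by
      rw [PiLp.inner_apply]
      exact sum_congr rfl fun x _ => by simp [mul_comm]
    -- The growth σ ^ r of the mass cancels against the normalisation, so the bound does not depend
    -- on r; the m - 1 levels then give the factor 1 - 1/m.
    have hlevel : ∀ r ∈ Ico 1 m, √σ * (φ i j + φ j i) / (m * C) ≤ ∑ x,
        ((if depth i x = r + 1 ∧ depth j x = r then w x else 0) +
          (if depth j x = r + 1 ∧ depth i x = r then w x else 0)) /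
            (m * (σ ^ (r - 1) * √σ * C)) := by
      intro r hr
      obtain ⟨hr1, hrm⟩ := mem_Ico.1 hr
      rw [← sum_div, sum_add_distrib, ← sum_filter, ← sum_filter, le_div_iff₀ (by positivity)]
      calc _ = (√σ) ^ 2 * σ ^ (r - 1) * (φ i j + φ j i) := by field_simp
        _ = σ ^ r * φ i j + σ ^ r * φ j i := by
          rw [Real.sq_sqrt hσ.le, ← pow_succ', Nat.sub_add_cancel hr1, mul_add]
        _ ≤ _ := add_le_add (hadj i j hij r hr1 hrm) (hadj j i hij.symm r hr1 hrm)
    rw [hinner, sum_congr rfl fun x _ => hpt x, sum_neg_distrib, sum_comm, neg_le_neg_iff,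
      add_sub_cancel_right, inv_div]
    refine le_trans ?_ (sum_le_sum hlevel)
    rw [sum_const, Nat.card_Ico, nsmul_eq_mul, Nat.cast_sub (by omega), Nat.cast_one,
      div_le_iff₀ (by positivity)]
    have hm1' : (0 : ℝ) < m - 1 := by
      have : (2 : ℝ) ≤ m := by exact_mod_cast hm
      linarith
    calc 2 * (1 - 1 / (m : ℝ)) * √σ = (m - 1) * √σ / (m * C) * (2 * C) := by field_simp
      _ ≤ (m - 1) * √σ / (m * C) * ((σ + 1) * (φ i j + φ j i)) := by gcongr
      _ = _ := by ring

end SimpleGraph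

/-! ### Non-backtracking successors in the graph with rays. -/

namespace SimpleGraph

open Finset

variable {V : Type*} {G : SimpleGraph V}

theorem Reachable.exists_adj_of_dist_eq_add_one {i b : V} {r : ℕ} (hr : G.Reachable i b)
    (hd : G.dist i b = r + 1) : ∃ a, G.Adj a b ∧ G.Reachable i a ∧ G.dist i a = r := by
  obtain ⟨p, hp⟩ := hr.exists_walk_length_eq_dist
  have hnil : ¬ p.Nil := fun h => by
    have := Walk.length_eq_zero_iff.2 h
    omega
  have hadj := p.adj_penultimate hnil
  have h1 := dist_le p.dropLast
  have h2 : p.dropLast.length + 1 = p.length := p.length_dropLast_add_one hnil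
  refine ⟨p.penultimate, hadj, p.dropLast.reachable, ?_⟩
  have h4 := (p.dropLast.reachable).dist_triangle_left b
  rw [dist_eq_one_iff_adj.2 hadj] at h4
  omega

/-- The depth seen from `i` of the elements of the graph in which an infinite ray is attached to
every vertex. A directed edge pointing away from `i` has the distance of its head, the element
`(u, t)` of the ray at `u` has depth `dist i u + t + 1`, and everything else has depth `0`. -/
noncomputable def rayDepth (G : SimpleGraph V) (m : ℕ) (i : V) : G.Dart ⊕ V × Fin m → ℕ :=
  open Classical in
  fun
  | .inl e => if G.Reachable i e.fst ∧ G.dist i e.snd = G.dist i e.fst + 1 then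
      G.dist i e.snd else 0
  | .inr (u, t) => if G.Reachable i u then G.dist i u + t + 1 else 0

/-- The non-backtracking successor relation in the graph with an infinite ray attached to every
vertex. -/
def RayChild (G : SimpleGraph V) (m : ℕ) : G.Dart ⊕ V × Fin m → G.Dart ⊕ V × Fin m → Prop
  | .inl e, .inl f => e.snd = f.fst ∧ e.fst ≠ f.snd
  | .inl e, .inr (u, t) => e.snd = u ∧ (t : ℕ) = 0
  | .inr _, .inl _ => False
  | .inr (u, t), .inr (u', t') => u = u' ∧ (t' : ℕ) = t + 1

/-- Weights on the graph with a ray attached to every vertex: a given function on the directed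
edges, and a geometric progression on each ray. -/
def rayWeight {m : ℕ} (σ : ℝ) (φ : G.Dart → ℝ) : G.Dart ⊕ V × Fin m → ℝ
  | .inl e => φ e
  | .inr (_, t) => σ ^ ((t : ℕ) + 1)

theorem rayDepth_inl_eq_add_one_iff {m : ℕ} {i : V} {e : G.Dart} {r : ℕ} :
    G.rayDepth m i (.inl e) = r + 1 ↔
      G.Reachable i e.fst ∧ G.dist i e.fst = r ∧ G.dist i e.snd = r + 1 := by
  rw [rayDepth]
  split_ifs with h
  · have := h.1
    simp only [this, true_and]
    omega
  · constructor
    · simp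
    · rintro ⟨h1, h2, h3⟩
      exact absurd ⟨h1, by omega⟩ h

theorem rayDepth_inr_eq_add_one_iff {m : ℕ} {i u : V} {t : Fin m} {r : ℕ} :
    G.rayDepth m i (.inr (u, t)) = r + 1 ↔ G.Reachable i u ∧ G.dist i u + t = r := by
  rw [rayDepth]
  split_ifs with h <;> simp [h]

/-- Up to half the girth, successors are one level deeper. -/
theorem RayChild.rayDepth_eq {m : ℕ} (hg : ((2 * m + 1 : ℕ) : ℕ∞) ≤ G.egirth) {i : V}
    {x y : G.Dart ⊕ V × Fin m} (hxy : G.RayChild m x y) (h1 : 1 ≤ G.rayDepth m i x)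
    (hm : G.rayDepth m i x < m) : G.rayDepth m i y = G.rayDepth m i x + 1 := by
  obtain ⟨r, hr⟩ : ∃ r, G.rayDepth m i x = r + 1 := ⟨_, (Nat.sub_add_cancel h1).symm⟩
  rw [hr] at hm ⊢
  match x, y, hxy with
  | .inl e, .inl f, ⟨hef, hne⟩ =>
    rw [rayDepth_inl_eq_add_one_iff] at hr ⊢
    obtain ⟨hre, hd, hd'⟩ := hr
    have hrs := hre.trans e.adj.reachable
    rw [← hef]
    refine ⟨hrs, hd', ?_⟩
    have hadj : G.Adj e.snd f.snd := hef ▸ f.adj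
    -- Equal distances contradict the girth; a decrease makes `f.snd` the unique closer neighbour
    -- `e.fst`, which is backtracking.
    rcases hadj.diff_dist_adj (u := i) with h | h | h
    · have := le_dist_of_adj_of_dist_eq hg hadj hrs h.symm
      omega
    · omega
    · exact absurd (eq_of_adj_of_dist_add_one hg e.adj hadj.symm hrs (by omega) (by omega)
        (by omega)) hne
  | .inl e, .inr (u, t), ⟨hu, ht⟩ =>
    rw [rayDepth_inl_eq_add_one_iff] at hr
    rw [rayDepth_inr_eq_add_one_iff, ← hu]
    exact ⟨hr.1.trans e.adj.reachable, by omega⟩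
  | .inr (u, t), .inr (u', t'), ⟨hu, ht⟩ =>
    rw [rayDepth_inr_eq_add_one_iff] at hr ⊢
    rw [← hu]
    exact ⟨hr.1, by omega⟩

/-- The predecessor is the last edge of a geodesic from i, or the preceding element of the ray. -/
theorem exists_rayChild {m r : ℕ} {i : V} {y : G.Dart ⊕ V × Fin m}
    (hy : G.rayDepth m i y = r + 1 + 1) : ∃ x, G.rayDepth m i x = r + 1 ∧ G.RayChild m x y := by
  match y with
  | .inl f =>
    rw [rayDepth_inl_eq_add_one_iff] at hy
    obtain ⟨a, ha, hra, hda⟩ := hy.1.exists_adj_of_dist_eq_add_one hy.2.1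
    refine ⟨.inl ⟨(a, f.fst), ha⟩, rayDepth_inl_eq_add_one_iff.2 ⟨hra, hda, hy.2.1⟩, rfl, ?_⟩
    rintro (rfl : a = f.snd)
    omega
  | .inr (u, ⟨0, h0⟩) =>
    rw [rayDepth_inr_eq_add_one_iff] at hy
    obtain ⟨a, ha, hra, hda⟩ := hy.1.exists_adj_of_dist_eq_add_one hy.2
    exact ⟨.inl ⟨(a, u), ha⟩, rayDepth_inl_eq_add_one_iff.2 ⟨hra, hda, hy.2⟩, rfl, rfl⟩
  | .inr (u, ⟨t + 1, ht⟩) =>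
    rw [rayDepth_inr_eq_add_one_iff] at hy
    refine ⟨.inr (u, ⟨t, by omega⟩), rayDepth_inr_eq_add_one_iff.2 ⟨hy.1, ?_⟩, rfl, rfl⟩
    have := hy.2
    dsimp only at this ⊢
    omega

/-- Two such darts would give their common head two neighbours closer to i. Hence the successor sets
of elements of one level are disjoint and their masses add. -/
theorem RayChild.eq_of_rayDepth_eq {m r : ℕ} (hg : ((2 * m + 1 : ℕ) : ℕ∞) ≤ G.egirth) {i : V}
    {x x' y : G.Dart ⊕ V × Fin m} (hxy : G.RayChild m x y) (hxy' : G.RayChild m x' y)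
    (hx : G.rayDepth m i x = r + 1) (hx' : G.rayDepth m i x' = r + 1) (hm : r + 1 ≤ m) :
    x = x' := by
  have key : ∀ e e' : G.Dart, e.snd = e'.snd → G.rayDepth m i (.inl e) = r + 1 →
      G.rayDepth m i (.inl e') = r + 1 → e = e' := by
    intro e e' h he he'
    rw [rayDepth_inl_eq_add_one_iff] at he he'
    have h1 : e.fst = e'.fst := eq_of_adj_of_dist_add_one hg e.adj (h ▸ e'.adj)
      (he.1.trans e.adj.reachable) (by omega) (by omega) (by omega)
    exact Dart.ext _ _ (Prod.ext h1 h)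
  match x, x', y, hxy, hxy' with
  | .inl e, .inl e', .inl f, h, h' => rw [key e e' (h.1.trans h'.1.symm) hx hx']
  | .inl e, .inl e', .inr (u, t), h, h' => rw [key e e' (h.1.trans h'.1.symm) hx hx']
  | .inl e, .inr (u', t'), .inr (u, t), h, h' =>
    have h1 := h.2
    have h2 := h'.2
    omega
  | .inr (u', t'), .inl e, .inr (u, t), h, h' =>
    have h1 := h.2
    have h2 := h'.2
    omega
  | .inr (u, t), .inr (u', t'), .inr (u'', t''), h, h' =>
    have h1 := h.2
    have h2 := h'.2
    rw [h.1, h'.1, Fin.ext (by omega : (t : ℕ) = t')]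

/-- Up to half the girth, the depths seen from adjacent vertices differ by exactly one. -/
theorem rayDepth_eq_add_one_or {m : ℕ} (hg : ((2 * m + 1 : ℕ) : ℕ∞) ≤ G.egirth) {i j : V}
    (hij : G.Adj i j) {x : G.Dart ⊕ V × Fin m} (hi : 1 ≤ G.rayDepth m i x)
    (him : G.rayDepth m i x ≤ m) (hj : 1 ≤ G.rayDepth m j x) :
    G.rayDepth m i x = G.rayDepth m j x + 1 ∨ G.rayDepth m j x = G.rayDepth m i x + 1 := by
  have key : ∀ u, G.Reachable i u → G.dist i u < m →
      G.dist i u = G.dist j u + 1 ∨ G.dist j u = G.dist i u + 1 := by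
    intro u hr hu
    have h := hij.diff_dist_adj (u := u)
    rw [dist_comm (u := u), dist_comm (u := u)] at h
    rcases h with h | h | h
    · have := le_dist_of_adj_of_dist_eq hg hij hr.symm (by rw [dist_comm, dist_comm (v := j), h])
      rw [dist_comm] at this
      omega
    · exact Or.inr h
    · have h0 : G.dist i u ≠ 0 ∨ G.dist i u = 0 := by omega
      rcases h0 with h0 | h0
      · left; omega
      · right
        rw [hr.dist_eq_zero_iff] at h0
        subst h0
        rw [dist_self, dist_eq_one_iff_adj.2 hij.symm]
  obtain ⟨r, hr⟩ : ∃ r, G.rayDepth m i x = r + 1 := ⟨_, (Nat.sub_add_cancel hi).symm⟩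
  obtain ⟨s, hs⟩ : ∃ s, G.rayDepth m j x = s + 1 := ⟨_, (Nat.sub_add_cancel hj).symm⟩
  rw [hr] at him
  rw [hr, hs]
  match x with
  | .inl e =>
    rw [rayDepth_inl_eq_add_one_iff] at hr hs
    have := key e.fst hr.1 (by omega)
    omega
  | .inr (u, t) =>
    rw [rayDepth_inr_eq_add_one_iff] at hr hs
    have := key u hr.1 (by omega)
    omega

/-- The elements of depth one seen from `i`, described by a neighbour `j`. -/
theorem rayDepth_eq_one_iff {m : ℕ} {i j : V} (hij : G.Adj i j) {x : G.Dart ⊕ V × Fin m} :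
    G.rayDepth m i x = 1 ↔
      x = .inl ⟨(i, j), hij⟩ ∨ G.RayChild m (.inl ⟨(j, i), hij.symm⟩) x := by
  match x with
  | .inl f =>
    rw [rayDepth_inl_eq_add_one_iff (r := 0)]
    have h1 : (G.Reachable i f.fst ∧ G.dist i f.fst = 0 ∧ G.dist i f.snd = 0 + 1) ↔
        i = f.fst := by
      constructor
      · rintro ⟨h, h', -⟩
        exact h.dist_eq_zero_iff.1 h'
      · intro h
        subst h
        exact ⟨.rfl, dist_self, dist_eq_one_iff_adj.2 f.adj⟩
    rw [h1]
    constructor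
    · intro h
      by_cases hj : j = f.snd
      · left
        congr 1
        exact Dart.ext _ _ (Prod.ext h.symm hj.symm)
      · exact Or.inr ⟨h, hj⟩
    · rintro (h | h)
      · rw [Sum.inl.injEq] at h
        rw [h]
      · exact h.1
  | .inr (u, t) =>
    rw [rayDepth_inr_eq_add_one_iff (r := 0)]
    constructor
    · rintro ⟨h, h'⟩
      exact Or.inr ⟨h.dist_eq_zero_iff.1 (by omega), by omega⟩
    · rintro (h | ⟨h, h'⟩)
      · exact absurd h (by simp)
      · obtain rfl : i = u := h
        exact ⟨.rfl, by simp [h']⟩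

open Classical in
/-- If `φ` solves `B φ + σ = σ φ`, the weights of the successors of an element add up to `σ` times
its own weight. -/
theorem sum_rayChild_rayWeight [Fintype V] {m : ℕ} {σ : ℝ} {φ : G.Dart → ℝ}
    (hφ : ∀ e, ∑ f : G.Dart, (if e.snd = f.fst ∧ e.fst ≠ f.snd then 1 else 0) * φ f + σ
      = σ * φ e) {i : V} {x : G.Dart ⊕ V × Fin m} (h1 : 1 ≤ G.rayDepth m i x)
    (hm : G.rayDepth m i x < m) :
    ∑ y with G.RayChild m x y, rayWeight σ φ y = σ * rayWeight σ φ x := by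
  obtain ⟨r, hr⟩ : ∃ r, G.rayDepth m i x = r + 1 := ⟨_, (Nat.sub_add_cancel h1).symm⟩
  rw [hr] at hm
  rw [sum_filter, Fintype.sum_sum_type]
  match x with
  | .inl e =>
    rw [rayWeight, ← hφ e]
    congr 1
    · refine sum_congr rfl fun f _ => ?_
      rw [ite_mul, one_mul, zero_mul]
      exact if_congr Iff.rfl rfl rfl
    -- The inhomogeneous term σ is the weight of the first ray element at the head of e.
    · rw [sum_eq_single (e.snd, ⟨0, by omega⟩)]
      · rw [if_pos ⟨rfl, rfl⟩]
        simp [rayWeight]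
      · rintro ⟨u, t⟩ - hne
        rw [if_neg]
        rintro ⟨h, h'⟩
        exact hne (Prod.ext h.symm (Fin.ext h'))
      · simp
  | .inr (u, t) =>
    rw [rayDepth_inr_eq_add_one_iff] at hr
    rw [sum_eq_zero fun f _ => if_neg (by simp [RayChild]), zero_add,
      sum_eq_single (u, ⟨t + 1, by omega⟩)]
    · rw [if_pos ⟨rfl, rfl⟩]
      simp only [rayWeight]
      ring
    · rintro ⟨u', t'⟩ - hne
      rw [if_neg]
      rintro ⟨h, h'⟩
      exact hne (Prod.ext h.symm (Fin.ext h'))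
    · simp

/-- Large girth and a solution `φ ≥ 1` of `B φ + σ = σ φ`, for the non-backtracking matrix `B`,
give a vector colouring. -/
theorem vectorColorable_of_nonBacktracking_eq [Fintype V] [DecidableEq V] [DecidableRel G.Adj]
    {m : ℕ} (hm : 2 ≤ m) (hg : ((2 * m + 1 : ℕ) : ℕ∞) ≤ G.egirth) {σ : ℝ} (hσ : 0 < σ)
    {φ : G.Dart → ℝ} (hφ1 : ∀ e, 0 ≤ φ e)
    (hφ : ∀ e, ∑ f : G.Dart, (if e.snd = f.fst ∧ e.fst ≠ f.snd then 1 else 0) * φ f + σ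
      = σ * φ e) :
    G.VectorColorable ((σ + 1) / (2 * (1 - 1 / (m : ℝ)) * √σ) + 1) := by
  classical
  have hw : ∀ x : G.Dart ⊕ V × Fin m, 0 ≤ rayWeight σ φ x
    | .inl e => hφ1 e
    | .inr (u, t) => by simp only [rayWeight]; positivity
  have hchild {i : V} {x : G.Dart ⊕ V × Fin m} (h1 : 1 ≤ G.rayDepth m i x)
      (h2 : G.rayDepth m i x < m) :
      ∑ y with G.RayChild m x y, rayWeight σ φ y = σ * rayWeight σ φ x := by
    convert sum_rayChild_rayWeight (m := m) (σ := σ) (φ := φ) (fun e => ?_) h1 h2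
    convert hφ e
  have hone : ∀ i j (hij : G.Adj i j), G.rayDepth m i (.inl ⟨(i, j), hij⟩) = 1 :=
    fun i j hij => (rayDepth_eq_one_iff hij).2 (Or.inl rfl)
  -- Mass is multiplied by σ from a subset of one level to its set of successors, since each
  -- successor is counted once.
  have hdouble : ∀ i r, r + 1 < m → ∀ s : Finset (G.Dart ⊕ V × Fin m),
      (∀ x ∈ s, G.rayDepth m i x = r + 1) →
      σ * ∑ x ∈ s, rayWeight σ φ x
        = ∑ y with ∃ x ∈ s, G.RayChild m x y, rayWeight σ φ y := by
    intro i r hr s hs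
    rw [mul_sum, sum_congr rfl fun x hx => (hchild (i := i) (by rw [hs x hx]; omega)
      (by rw [hs x hx]; omega)).symm, ← sum_biUnion]
    · refine sum_congr ?_ fun _ _ => rfl
      ext y
      simp
    · intro x hx x' hx' hne
      rw [Function.onFun, Finset.disjoint_left]
      intro y hy hy'
      rw [mem_filter] at hy hy'
      exact hne (hy.2.eq_of_rayDepth_eq hg hy'.2 (hs x hx) (hs x' hx') (by omega))
  refine vectorColorable_of_depth hm hσ (rayWeight σ φ) hw (G.rayDepth m)
    (fun i => ∑ x with G.rayDepth m i x = 1, rayWeight σ φ x) (fun i => ?_) (fun i r h1 hr => ?_)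
    (fun i j hij x hi him hj _ => rayDepth_eq_add_one_or hg hij hi him hj)
    (fun i j => if h : G.Adj i j then φ ⟨(i, j), h⟩ else 0) (fun i j hij => ?_)
    (fun i j hij => ?_) (fun i j hij r h1 hr => ?_)
  -- The ray at i contributes σ > 0, even when i is isolated.
  · refine sum_pos' (fun x _ => hw x) ⟨.inr (i, ⟨0, by omega⟩), ?_, ?_⟩
    · rw [mem_filter]
      exact ⟨mem_univ _, rayDepth_inr_eq_add_one_iff.2 ⟨.rfl, by simp⟩⟩
    · simpa [rayWeight] using hσ
  · induction r, h1 using Nat.le_induction with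
    | base => simp
    | succ r h1 ih =>
      obtain ⟨r, rfl⟩ : ∃ s, r = s + 1 := ⟨r - 1, by omega⟩
      have := ih (by omega)
      rw [add_tsub_cancel_right] at this ⊢
      rw [pow_succ', mul_assoc, ← this, hdouble i r (by omega) _ (by simp)]
      refine sum_congr ?_ fun _ _ => rfl
      ext y
      simp only [mem_filter, mem_univ, true_and]
      constructor
      · exact exists_rayChild
      · rintro ⟨x, hx, hxy⟩
        rw [hxy.rayDepth_eq hg (by omega) (by omega), hx]
  · rw [dif_pos hij]
    exact hφ1 _
  · rw [dif_pos hij, dif_pos hij.symm]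
    have h2 := hchild (hone j i hij.symm).ge (by rw [hone]; omega)
    rw [rayWeight] at h2
    rw [← h2, show φ ⟨(i, j), hij⟩ = rayWeight (m := m) σ φ (.inl ⟨(i, j), hij⟩) from rfl,
      ← sum_insert (fun h => (mem_filter.1 h).2.2 rfl)]
    refine sum_congr ?_ fun _ _ => rfl
    ext x
    simp [rayDepth_eq_one_iff hij]
  · rw [dif_pos hij]
    induction r, h1 using Nat.le_induction with
    | base =>
      have h2 := hchild (hone i j hij).ge (by rw [hone]; omega)
      rw [rayWeight] at h2
      rw [pow_one, ← h2]
      refine sum_le_sum_of_subset_of_nonneg (fun y hy => ?_) fun x _ _ => hw x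
      rw [mem_filter] at hy ⊢
      refine ⟨mem_univ _, ?_, (rayDepth_eq_one_iff hij.symm).2 (Or.inr hy.2)⟩
      rw [hy.2.rayDepth_eq hg (hone i j hij).ge (by rw [hone]; omega), hone]
    | succ r h1 ih =>
      rw [pow_succ', mul_assoc]
      refine (mul_le_mul_of_nonneg_left (ih (by omega)) hσ.le).trans ?_
      rw [hdouble i r (by omega) _ (by simp +contextual)]
      refine sum_le_sum_of_subset_of_nonneg (fun y hy => ?_) fun x _ _ => hw x
      simp only [mem_filter, mem_univ, true_and] at hy ⊢
      obtain ⟨x, ⟨hx, hx'⟩, hxy⟩ := hy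
      rw [hxy.rayDepth_eq hg (i := i) (by omega) (by omega),
        hxy.rayDepth_eq hg (i := j) (by omega) (by omega), hx, hx']
      exact ⟨rfl, rfl⟩

end SimpleGraph

/-! ### The non-backtracking spectral radius. -/

namespace SimpleGraph

variable {V : Type*} [Fintype V] [DecidableEq V] {G : SimpleGraph V} [DecidableRel G.Adj]

/-- For `σ` beyond the spectral radius of the non-backtracking matrix `B`, there is a solution
`φ ≥ 1` of `B φ + σ = σ φ`. -/
theorem exists_nonBacktracking_eq {σ : ℝ} (hσ : G.nonBacktrackingRadius < σ) :
    ∃ φ : G.Dart → ℝ, (∀ e, 1 ≤ φ e) ∧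
      ∀ e, ∑ f : G.Dart, (if e.snd = f.fst ∧ e.fst ≠ f.snd then 1 else 0) * φ f + σ = σ * φ e := by
  refine Matrix.exists_one_le_mulVec_add_eq_smul
    (Matrix.of fun e f : G.Dart => if e.snd = f.fst ∧ e.fst ≠ f.snd then (1 : ℝ) else 0)
    (fun e f => ?_) ?_
  · rw [Matrix.of_apply]
    positivity
  · have : (Matrix.of fun e f : G.Dart => if e.snd = f.fst ∧ e.fst ≠ f.snd then (1 : ℝ) else 0).map
        ((↑) : ℝ → ℂ) = G.nonBacktrackingMatrix := by
      ext e f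
      simp [nonBacktrackingMatrix, apply_ite]
    rw [this]
    exact hσ

/-- The non-backtracking matrix of a graph with a cycle has spectral radius at least one. -/
theorem one_le_nonBacktrackingRadius (hG : ¬ G.IsAcyclic) : 1 ≤ G.nonBacktrackingRadius := by
  by_contra! hlt
  obtain ⟨σ, hσ, hσ1⟩ := exists_between hlt
  have hσ0 : 0 ≤ σ := ENNReal.toReal_nonneg.trans hσ.le
  obtain ⟨φ, hφ1, hφ⟩ := exists_nonBacktracking_eq hσ
  -- With σ < 1, φ f + σ ≤ σ φ e makes φ strictly decrease along non-backtracking steps, which is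
  -- impossible around a cycle.
  have hstep : ∀ e f : G.Dart, e.snd = f.fst → e.fst ≠ f.snd → φ f < φ e := by
    intro e f h h'
    have h1 := Finset.single_le_sum (f := fun f : G.Dart =>
      (if e.snd = f.fst ∧ e.fst ≠ f.snd then 1 else 0) * φ f) (fun g _ => by
        have := hφ1 g
        positivity) (Finset.mem_univ f)
    rw [if_pos ⟨h, h'⟩, one_mul] at h1
    nlinarith [hφ e, hφ1 e]
  rw [IsAcyclic] at hG
  push Not at hG
  obtain ⟨v, c, hc⟩ := hG
  have hlen := hc.three_le_length
  let d : ∀ k, k < c.length → G.Dart := fun k hk =>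
    ⟨(c.getVert k, c.getVert (k + 1)), c.adj_getVert_succ hk⟩
  have hle : ∀ k (hk : k < c.length), φ (d k hk) ≤ φ (d 0 (by omega)) := by
    intro k
    induction k with
    | zero => exact fun _ => le_rfl
    | succ k ih =>
      intro hk
      refine (hstep (d k (by omega)) (d (k + 1) hk) rfl ?_).le.trans (ih (by omega))
      exact hc.getVert_sub_one_ne_getVert_add_one (i := k + 1) (by omega)
  refine (hle (c.length - 1) (by omega)).not_gt (hstep _ _ ?_ ?_)
  · simp [d, Nat.sub_add_cancel (by omega : 1 ≤ c.length)]
  · exact hc.snd_ne_penultimate.symm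

end SimpleGraph

/-! ### The limit σ → ρ from above. -/

open Filter Topology in
theorem theorem3 {V : Type*} [Fintype V] [DecidableEq V] (G : SimpleGraph V) [DecidableRel G.Adj]
    (hcycle : ¬ G.IsAcyclic) (m : ℕ) (hm : 2 ≤ m) (hgirth : ((2 * m + 1 : ℕ) : ℕ∞) ≤ G.egirth) :
    G.vectorChromaticNumber ≤
      (G.nonBacktrackingRadius + 1) /
        (2 * (1 - 1 / (m : ℝ)) * Real.sqrt G.nonBacktrackingRadius) + 1 := by
  have hρ := SimpleGraph.one_le_nonBacktrackingRadius hcycle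
  set ρ := G.nonBacktrackingRadius with hρdef
  have hm1 : (0 : ℝ) < 1 - 1 / (m : ℝ) := by
    rw [sub_pos, div_lt_one (by positivity)]
    exact_mod_cast (by omega : 1 < m)
  have hbound : ∀ σ, ρ < σ →
      G.vectorChromaticNumber ≤ (σ + 1) / (2 * (1 - 1 / (m : ℝ)) * √σ) + 1 := by
    intro σ hσ
    obtain ⟨φ, hφ1, hφ⟩ := SimpleGraph.exists_nonBacktracking_eq hσ
    exact csInf_le G.bddBelow_vectorColorable
      (SimpleGraph.vectorColorable_of_nonBacktracking_eq hm hgirth (by linarith)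
        (fun e => zero_le_one.trans (hφ1 e)) hφ)
  have hcont : ContinuousAt (fun σ : ℝ => (σ + 1) / (2 * (1 - 1 / (m : ℝ)) * √σ) + 1) ρ := by
    have : 2 * (1 - 1 / (m : ℝ)) * √ρ ≠ 0 := by
      have : 0 < √ρ := Real.sqrt_pos.2 (by linarith)
      positivity
    fun_prop (disch := assumption)
  exact ge_of_tendsto (hcont.tendsto.mono_left (nhdsWithin_le_nhds (s := Set.Ioi ρ)))
    (eventually_nhdsWithin_of_forall hbound)
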